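/- Let $V$ be a finite-dimensional vector space over the finite field $\mathbb{F}_q$, equipped with a form of one of the following kinds: a non-degenerate alternating bilinear form, a non-degenerate Hermitian form (with respect to an involution $\sigma\neq\mathrm{id}$ of $\mathbb{F}_q$), or a non-singular quadratic form. Let $\mathcal{Q}$ be the associated finite classical polar space, i.e. the set of all subspaces of $V$ that are totally isotropic (respectively, in the quadratic case, totally singular), and let $r$ be its rank, the maximal dimension of a subspace in $\mathcal{Q}$. Put $n=\dim V$ and let $\epsilon = 0$ in the alternating case, $\epsilon = n-2r-\tfrac12$ in the Hermitian case, and $\epsilon = n-2r-1$ in the quadratic case. The points of $\mathcal{Q}$ are its $1$-dimensional subspaces. The collinearity graph of $\mathcal{Q}$ has the points as vertices, two distinct points being adjacent if and only if the line they span belongs to $\mathcal{Q}$. Let $m_1$ be the multiplicity of $\theta_1=q^{r-1}-1$ as an eigenvalue of the adjacency matrix of this graph. Let $t,k\in\{0,\dots,r\}$ with $t\ge 2$, let $\lambda\ge 1$ be an integer, and let $D$ be a $t$-$(r,k,\lambda)_Q$ design in $\mathcal{Q}$, i.e. a set of $k$-dimensional subspaces of $\mathcal{Q}$ (called blocks)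 such that every $t$-dimensional subspace of $\mathcal{Q}$ is contained in exactly $\lambda$ elements of $D$. Let $N$ be the real $0/1$ point-block incidence matrix of $D$, with rows indexed by the points of $\mathcal{Q}$ and columns by the blocks. Then $$\operatorname{rank}(N)=\begin{cases}1+m_1 & \text{if } k=r,\\ \#\{\text{points of }\mathcal{Q}\} & \text{if } k<r,\end{cases}$$ and $$m_1=q^{\epsilon+1}\cdot\frac{q^{r+\epsilon-1}+1}{q^{\epsilon}+1}\cdot\frac{q^r-1}{q-1}.$$ -/

import Mathlib

universe u v

noncomputable section

/-- A form defining a finite classical polar space with ambient space `V`: a non-degenerate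
alternating bilinear form, a non-degenerate Hermitian form with respect to an involution
`σ ≠ id` of the field, or a non-singular quadratic form. (`QuadraticMap.Nondegenerate` is
non-singularity in every characteristic: no nonzero singular vector lies in the radical of the
polar form, and that radical has dimension at most one.) -/
inductive ClassicalPolarSpace (K : Type u) (V : Type v) [Field K] [AddCommGroup V] [Module K V]
  | symplectic (B : V →ₗ[K] V →ₗ[K] K) (alt : B.IsAlt) (nondeg : B.Nondegenerate)
  | hermitian (σ : K →+* K) (σ_invol : Function.Involutive σ) (σ_ne : σ ≠ RingHom.id K)
      (B : V →ₛₗ[σ] V →ₗ[K] K) (herm : B.IsSymm) (nondeg : B.Nondegenerate)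
  | quadratic (F : QuadraticForm K V) (nondeg : F.Nondegenerate)

namespace ClassicalPolarSpace

variable {K : Type u} {V : Type v} [Field K] [AddCommGroup V] [Module K V]

/-- The subspaces of `V` belonging to the polar space: those which are totally isotropic
(symplectic and Hermitian case) or totally singular (quadratic case). -/
def Contains : ClassicalPolarSpace K V → Submodule K V → Prop
  | symplectic B _ _, U => ∀ x ∈ U, ∀ y ∈ U, B x y = 0
  | hermitian _ _ _ B _ _, U => ∀ x ∈ U, ∀ y ∈ U, B x y = 0
  | quadratic F _, U => ∀ x ∈ U, F x = 0

/-- The `k`-dimensional subspaces of the polar space. -/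
def subspaces (𝒬 : ClassicalPolarSpace K V) (k : ℕ) : Set (Submodule K V) :=
  {U | 𝒬.Contains U ∧ Module.finrank K U = k}

/-- The rank: the maximal dimension of a subspace of the polar space. -/
def rank (𝒬 : ClassicalPolarSpace K V) : ℕ :=
  sSup {k | (𝒬.subspaces k).Nonempty}

/-- The maximum in the definition of the rank is attained. -/
theorem isGreatest_rank [FiniteDimensional K V] (𝒬 : ClassicalPolarSpace K V) :
    IsGreatest {k | (𝒬.subspaces k).Nonempty} 𝒬.rank := by
  have hb : BddAbove {k | (𝒬.subspaces k).Nonempty} := by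
    refine ⟨Module.finrank K V, ?_⟩
    rintro k ⟨U, -, rfl⟩
    exact Submodule.finrank_le U
  have h0 : {k | (𝒬.subspaces k).Nonempty}.Nonempty := by
    refine ⟨0, ⊥, ?_, finrank_bot K V⟩
    cases 𝒬 <;> simp [Contains]
  exact ⟨Nat.sSup_mem h0 hb, fun k hk => le_csSup hb hk⟩

/-- The parameter `ε` of the type, where `n = dim V` and `r` is the rank: `0` for
`Sp` (`n = 2r`); `-1/2`, `1/2` for `U⁺` (`n = 2r`), `U⁻` (`n = 2r + 1`); and `-1`, `0`, `1` for
`Ω⁺` (`n = 2r`), `Ω` (`n = 2r + 1`), `Ω⁻` (`n = 2r + 2`). -/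
def eps (𝒬 : ClassicalPolarSpace K V) : ℝ :=
  match 𝒬 with
  | symplectic _ _ _ => 0
  | hermitian _ _ _ _ _ _ => (Module.finrank K V : ℝ) - 2 * 𝒬.rank - 1 / 2
  | quadratic _ _ => (Module.finrank K V : ℝ) - 2 * 𝒬.rank - 1

/-- The points of the polar space. -/
abbrev Point (𝒬 : ClassicalPolarSpace K V) : Type v := 𝒬.subspaces 1

/-- Two distinct points are adjacent iff the line they span is contained in the polar space. -/
def collinearityGraph (𝒬 : ClassicalPolarSpace K V) : SimpleGraph 𝒬.Point where
  Adj P P' := P ≠ P' ∧ 𝒬.Contains ((P : Submodule K V) ⊔ (P' : Submodule K V))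
  symm := ⟨fun _ _ h => ⟨h.1.symm, by rw [sup_comm]; exact h.2⟩⟩
  loopless := ⟨fun _ h => h.1 rfl⟩

/-- `D` is a `t`-`(r, k, lam)` design in the polar space, `r` being its rank. -/
structure IsDesign (𝒬 : ClassicalPolarSpace K V) (t k lam : ℕ) (D : Set (Submodule K V)) :
    Prop where
  t_le : t ≤ 𝒬.rank
  k_le : k ≤ 𝒬.rank
  subset : D ⊆ 𝒬.subspaces k
  ncard_eq : ∀ T ∈ 𝒬.subspaces t, {B | B ∈ D ∧ T ≤ B}.ncard = lam

open Classical in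
/-- The point-block incidence matrix of a set of blocks, over the reals. -/
def incidenceMatrix (𝒬 : ClassicalPolarSpace K V) (D : Set (Submodule K V)) :
    Matrix 𝒬.Point D ℝ :=
  Matrix.of fun P B => if (P : Submodule K V) ≤ (B : Submodule K V) then 1 else 0

section Finite

variable [Finite K] [FiniteDimensional K V]

instance instFiniteSubmodule : Finite (Submodule K V) :=
  haveI : Finite V := Module.finite_of_finite K
  Finite.of_injective (fun U : Submodule K V => (U : Set V)) SetLike.coe_injective

instance instFintypeSetSubmodule (D : Set (Submodule K V)) : Fintype D := Fintype.ofFinite D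

open Classical in
/-- The multiplicity of `θ` as an eigenvalue of the adjacency matrix of the collinearity graph
(zero if it is not an eigenvalue). -/
def eigenvalueMultiplicity (𝒬 : ClassicalPolarSpace K V) (θ : ℝ) : ℕ :=
  Module.finrank ℝ
    (Module.End.eigenspace (Matrix.toLin' (𝒬.collinearityGraph.adjMatrix ℝ)) θ)

/-- The multiplicity `m₁` of the eigenvalue `θ₁ = q ^ (r - 1) - 1` of the collinearity graph,
where `q` is the order of the field and `r ≥ 1` is the rank. -/
def m₁ (𝒬 : ClassicalPolarSpace K V) : ℕ :=
  𝒬.eigenvalueMultiplicity ((Nat.card K : ℝ) ^ (𝒬.rank - 1) - 1)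

end Finite

end ClassicalPolarSpace

end

/-!
The symplectic, Hermitian and quadratic cases are treated at once by `FormData`, which records a
reflexive sesquilinear form, the singular vectors, and the number `h` of singular vectors on a coset
`y + ⟨x⟩` with `x` singular and not orthogonal to `y`; here `h` is `q`, `√q` or `1`.

By induction from the maximal subspaces downwards, `h` determines the number of singular vectors
orthogonal to a subspace of the polar space of given dimension (`FormData.count_eq`): a maximal
subspace is orthogonal to no singular vectors but its own, and the constant `h` controls how the
number changes when the subspace grows by one dimension (`FormData.count_sub_count`). With
`e = q ^ (r + ε - 1)`, these counts make the collinearity graph strongly regular. Its adjacency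
matrix plus one, `C`, satisfies `(C - q ^ (r - 1)) (C + e) = c J` with `J` the all-ones matrix
(`FormData.collinMatrix_mul_self`). The projections onto the eigenspaces are then polynomials in `C`
and `J`, and their traces give the multiplicities (`Matrix.finrank_eigenspace_of_sq_eq`).

A design of strength `t ≥ 2` also has strengths `1` and `2`, by counting pairs of a vector and a
block (`FormData.exists_ncard_blocks_eq`), say with `λ₁` and `λ₂` blocks on a point and on a line.
Hence `N Nᵀ = λ₁ + λ₂ (C - 1)`, and the rank of `N`, which is that of `N Nᵀ`, is the number of points
minus the multiplicity of `1 - λ₁ / λ₂` as an eigenvalue of `C`. Counting gives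
`λ₁ / λ₂ = (q ^ (r - 1) - 1) (1 + e) / (q ^ (k - 1) - 1)`, so that this number is the least
eigenvalue `-e` if `k = r`, and smaller than every eigenvalue if `k < r`.
-/

/-! ### Forms with a uniform count of singular vectors -/

namespace ClassicalPolarSpace

variable {K : Type u} {V : Type v} [Field K] [AddCommGroup V] [Module K V]

/-- A uniform description of the form behind a classical polar space: a reflexive sesquilinear
form `B` together with the set `Sing` of singular vectors. The number `h` counts the singular
vectors `y + a • x` on a coset of the line spanned by a singular vector `x` not orthogonal to `y`;
it distinguishes the three kinds of forms. -/
structure FormData (𝒬 : ClassicalPolarSpace K V) where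
  /-- The automorphism of the field. -/
  σ : K →+* K
  /-- The form; in the quadratic case, the polar form. -/
  B : V →ₛₗ[σ] V →ₗ[K] K
  /-- The isotropic or singular vectors. -/
  Sing : V → Prop
  /-- The number of singular vectors on the cosets described above. -/
  h : ℕ
  isRefl : B.IsRefl
  sing_zero : Sing 0
  sing_smul : ∀ (a : K) {x : V}, Sing x → Sing (a • x)
  sing_add : ∀ {x y : V}, Sing x → Sing y → B x y = 0 → Sing (x + y)
  self_eq_zero : ∀ {x : V}, Sing x → B x x = 0
  eq_zero : ∀ {x : V}, Sing x → (∀ y, B x y = 0) → x = 0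
  card_sing : ∀ {x y : V}, Sing x → B x y ≠ 0 → Nat.card {a : K // Sing (y + a • x)} = h
  h_pos : 0 < h
  contains_iff : ∀ U : Submodule K V,
    𝒬.Contains U ↔ (∀ x ∈ U, Sing x) ∧ ∀ x ∈ U, ∀ y ∈ U, B x y = 0

namespace FormData

variable {𝒬 : ClassicalPolarSpace K V} (Φ : FormData 𝒬)

/-- The subspace of all vectors orthogonal to `W`. -/
def perp (W : Submodule K V) : Submodule K V where
  carrier := {y | ∀ x ∈ W, Φ.B x y = 0}
  zero_mem' := by simp
  add_mem' := by
    intro a b ha hb x hx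
    rw [map_add, ha x hx, hb x hx, add_zero]
  smul_mem' := by
    intro c a ha x hx
    rw [map_smul, ha x hx, smul_zero]

/-- The number of singular vectors orthogonal to `W`. -/
noncomputable def count (W : Submodule K V) : ℕ := {x | Φ.Sing x ∧ x ∈ Φ.perp W}.ncard

theorem mem_perp {W : Submodule K V} {y : V} : y ∈ Φ.perp W ↔ ∀ x ∈ W, Φ.B x y = 0 := Iff.rfl

theorem perp_comm {x y : V} : Φ.B x y = 0 ↔ Φ.B y x = 0 := ⟨Φ.isRefl x y, Φ.isRefl y x⟩

theorem le_perp_comm {U W : Submodule K V} : U ≤ Φ.perp W ↔ W ≤ Φ.perp U :=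
  ⟨fun H _ hx _ hy => Φ.isRefl _ _ (H hy _ hx), fun H _ hx _ hy => Φ.isRefl _ _ (H hy _ hx)⟩

theorem perp_sup (U W : Submodule K V) : Φ.perp (U ⊔ W) = Φ.perp U ⊓ Φ.perp W := by
  apply le_antisymm
  · exact le_inf (fun y hy x hx => hy x (Submodule.mem_sup_left hx))
      (fun y hy x hx => hy x (Submodule.mem_sup_right hx))
  · rintro y ⟨h1, h2⟩ x hx
    obtain ⟨a, ha, b, hb, rfl⟩ := Submodule.mem_sup.1 hx
    rw [map_add, LinearMap.add_apply, h1 a ha, h2 b hb, add_zero]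

theorem mem_perp_span_singleton {x y : V} :
    y ∈ Φ.perp (Submodule.span K {x}) ↔ Φ.B x y = 0 := by
  refine ⟨fun H => H x (Submodule.mem_span_singleton_self x), fun H z hz => ?_⟩
  obtain ⟨a, rfl⟩ := Submodule.mem_span_singleton.1 hz
  rw [map_smulₛₗ, LinearMap.smul_apply, H, smul_zero]

theorem perp_bot : Φ.perp ⊥ = ⊤ := by
  refine eq_top_iff.2 fun y _ x hx => ?_
  rw [(Submodule.mem_bot K).1 hx, map_zero, LinearMap.zero_apply]

theorem contains_iff_le_perp {U : Submodule K V} :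
    𝒬.Contains U ↔ (∀ x ∈ U, Φ.Sing x) ∧ U ≤ Φ.perp U := by
  rw [Φ.contains_iff]
  exact and_congr_right fun _ => ⟨fun H y hy x hx => H x hx y hy, fun H x hx y hy => H hy x hx⟩

include Φ in
theorem contains_mono {U W : Submodule K V} (h : U ≤ W) (hW : 𝒬.Contains W) : 𝒬.Contains U := by
  rw [Φ.contains_iff] at hW ⊢
  exact ⟨fun x hx => hW.1 x (h hx), fun x hx y hy => hW.2 x (h hx) y (h hy)⟩

theorem contains_sup_iff {U W : Submodule K V} (hU : 𝒬.Contains U) (hW : 𝒬.Contains W) :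
    𝒬.Contains (U ⊔ W) ↔ W ≤ Φ.perp U := by
  rw [Φ.contains_iff_le_perp] at hU hW ⊢
  refine ⟨fun H y hy x hx => H.2 (Submodule.mem_sup_right hy) x (Submodule.mem_sup_left hx),
    fun H => ⟨?_, ?_⟩⟩
  · intro x hx
    obtain ⟨a, ha, b, hb, rfl⟩ := Submodule.mem_sup.1 hx
    exact Φ.sing_add (hU.1 a ha) (hW.1 b hb) (H hb a ha)
  · rw [perp_sup]
    exact sup_le (le_inf hU.2 (Φ.le_perp_comm.1 H)) (le_inf H hW.2)

theorem contains_span_singleton {x : V} : 𝒬.Contains (Submodule.span K {x}) ↔ Φ.Sing x := by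
  rw [Φ.contains_iff]
  refine ⟨fun H => H.1 x (Submodule.mem_span_singleton_self x), fun H => ⟨?_, ?_⟩⟩
  · intro y hy
    obtain ⟨a, rfl⟩ := Submodule.mem_span_singleton.1 hy
    exact Φ.sing_smul a H
  · intro y hy z hz
    obtain ⟨a, rfl⟩ := Submodule.mem_span_singleton.1 hy
    obtain ⟨b, rfl⟩ := Submodule.mem_span_singleton.1 hz
    simp [map_smulₛₗ, Φ.self_eq_zero H]

theorem contains_sup_span_singleton_iff {U : Submodule K V} {x : V} (hU : 𝒬.Contains U) :
    𝒬.Contains (U ⊔ Submodule.span K {x}) ↔ Φ.Sing x ∧ x ∈ Φ.perp U := by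
  constructor
  · intro H
    have hx := Φ.contains_mono le_sup_right H
    refine ⟨Φ.contains_span_singleton.1 hx, ?_⟩
    exact (Φ.contains_sup_iff hU hx).1 H (Submodule.mem_span_singleton_self x)
  · rintro ⟨hx, hxU⟩
    rw [Φ.contains_sup_iff hU (Φ.contains_span_singleton.2 hx),
      Submodule.span_singleton_le_iff_mem]
    exact hxU

end FormData

theorem finrank_sup_span_singleton [FiniteDimensional K V] {U : Submodule K V} {x : V}
    (hx : x ∉ U) :
    Module.finrank K (U ⊔ Submodule.span K {x} : Submodule K V) = Module.finrank K U + 1 := by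
  have hx0 : x ≠ 0 := fun h => hx (h ▸ U.zero_mem)
  have h := Submodule.finrank_sup_add_finrank_inf_eq U (Submodule.span K {x})
  have hd : U ⊓ Submodule.span K {x} = ⊥ :=
    ((Submodule.disjoint_span_singleton' hx0).2 hx).eq_bot
  rw [hd, finrank_bot, finrank_span_singleton hx0] at h
  simpa using h

namespace FormData

variable {𝒬 : ClassicalPolarSpace K V} (Φ : FormData 𝒬)

/-! ### Dimensions of orthogonal subspaces -/

section Finite

variable [Finite K] [FiniteDimensional K V]

omit [FiniteDimensional K V] in
theorem surjective_σ : Function.Surjective Φ.σ :=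
  Finite.surjective_of_injective Φ.σ.injective

theorem finrank_perp {S : Submodule K V} (hS : 𝒬.Contains S) :
    Module.finrank K S + Module.finrank K (Φ.perp S) = Module.finrank K V := by
  have : RingHomSurjective Φ.σ := ⟨Φ.surjective_σ⟩
  have : Finite V := Module.finite_of_finite K
  have hperp : Φ.perp S = (S.map Φ.B).dualCoannihilator := by
    ext y
    simp [Submodule.mem_dualCoannihilator, mem_perp]
  -- The restriction of `B` to `S` is only semilinear, so dimensions are compared by cardinality.
  have hcard : Nat.card (S.map Φ.B) = Nat.card S := by
    have hinj : Set.InjOn Φ.B (S : Set V) := by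
      intro x hx y hy hxy
      rw [← sub_eq_zero]
      refine Φ.eq_zero (((Φ.contains_iff S).1 hS).1 _ (S.sub_mem hx hy)) fun z => ?_
      rw [map_sub, hxy, sub_self, LinearMap.zero_apply]
    exact Nat.card_image_of_injOn hinj
  rw [Module.natCard_eq_pow_finrank (K := K) (V := S.map Φ.B),
    Module.natCard_eq_pow_finrank (K := K) (V := S)] at hcard
  have hdim := Nat.pow_right_injective (Finite.one_lt_card (α := K)) hcard
  rw [← hdim, hperp]
  exact Subspace.finrank_add_finrank_dualCoannihilator_eq _

include Φ in
/-- A subspace of the polar space of less than maximal dimension extends inside the polar space: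
by a dimension count, a maximal subspace contains a vector orthogonal to it and outside it. -/
theorem exists_sing_of_finrank_lt {S : Submodule K V} (hS : 𝒬.Contains S)
    (hr : Module.finrank K S < 𝒬.rank) : ∃ x, Φ.Sing x ∧ x ∈ Φ.perp S ∧ x ∉ S := by
  obtain ⟨M, hM, hMr⟩ := 𝒬.isGreatest_rank.1
  have hMp := (Φ.contains_iff_le_perp.1 hM)
  by_contra! hcon
  have hle : M ⊓ Φ.perp S ≤ M ⊓ S := fun x hx =>
    ⟨hx.1, hcon x (hMp.1 x hx.1) hx.2⟩
  have h1 := Submodule.finrank_mono hle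
  have h2 := Submodule.finrank_sup_add_finrank_inf_eq M (Φ.perp S)
  have hsub : M ⊔ Φ.perp S ≤ Φ.perp (M ⊓ S) :=
    sup_le (fun y hy x hx => hMp.2 hy x hx.1) (fun y hy x hx => hy x hx.2)
  have h3 := Submodule.finrank_mono hsub
  have h4 := Φ.finrank_perp (Φ.contains_mono (inf_le_right : M ⊓ S ≤ S) hS)
  have h5 := Φ.finrank_perp hS
  omega

include Φ in
theorem subspaces_nonempty {s : ℕ} (hs : s ≤ 𝒬.rank) : (𝒬.subspaces s).Nonempty := by
  induction s with
  | zero => exact ⟨⊥, Φ.contains_mono bot_le 𝒬.isGreatest_rank.1.choose_spec.1, finrank_bot K V⟩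
  | succ s ih =>
    obtain ⟨S, hS, rfl⟩ := ih (by omega)
    obtain ⟨x, hx, hxp, hxS⟩ := Φ.exists_sing_of_finrank_lt hS (by omega)
    exact ⟨_, (Φ.contains_sup_span_singleton_iff hS).2 ⟨hx, hxp⟩, finrank_sup_span_singleton hxS⟩

/-! ### Counting singular vectors -/

theorem card_mul_ncard_sing {W : Submodule K V} {x : V} (hx : Φ.Sing x) (hxW : x ∈ W) :
    Nat.card K * {y | Φ.Sing y ∧ y ∈ W ∧ Φ.B x y ≠ 0}.ncard =
      Φ.h * {y | y ∈ W ∧ Φ.B x y ≠ 0}.ncard := by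
  classical
  have : Finite V := Module.finite_of_finite K
  have := Fintype.ofFinite {y // y ∈ W ∧ Φ.B x y ≠ 0}
  have key : ∀ (y : V) (a : K), y + a • x ∈ W ∧ Φ.B x (y + a • x) ≠ 0 ↔
      y ∈ W ∧ Φ.B x y ≠ 0 := by
    intro y a
    rw [map_add, map_smul, Φ.self_eq_zero hx, smul_zero, add_zero,
      W.add_mem_iff_left (W.smul_mem a hxW)]
  -- Count the pairs `(y, a)` with `y + a • x` singular in two ways.
  let E : ({y // Φ.Sing y ∧ y ∈ W ∧ Φ.B x y ≠ 0} × K) ≃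
      Σ y : {y // y ∈ W ∧ Φ.B x y ≠ 0}, {a : K // Φ.Sing (y.1 + a • x)} :=
    { toFun := fun z => ⟨⟨z.1.1 - z.2 • x, (key _ z.2).1 (by simpa using z.1.2.2)⟩,
        ⟨z.2, by simpa using z.1.2.1⟩⟩
      invFun := fun z => (⟨z.1.1 + z.2.1 • x, z.2.2, (key _ _).2 z.1.2⟩, z.2.1)
      left_inv := by rintro ⟨⟨z, hz⟩, a⟩; simp
      right_inv := by
        rintro ⟨⟨z, hz⟩, ⟨a, ha⟩⟩
        refine Sigma.ext (by simp) ?_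
        refine (Subtype.heq_iff_coe_eq ?_).2 rfl
        simp }
  have h := Nat.card_congr E
  rw [Nat.card_prod, Nat.card_sigma, Finset.sum_congr rfl
    (fun y _ => Φ.card_sing hx y.2.2), Finset.sum_const, Finset.card_univ, smul_eq_mul,
    ← Nat.card_eq_fintype_card] at h
  rw [mul_comm, mul_comm Φ.h]
  exact h

theorem count_eq_add {S : Submodule K V} {x : V} :
    Φ.count S = Φ.count (S ⊔ Submodule.span K {x}) +
      {y | Φ.Sing y ∧ y ∈ Φ.perp S ∧ Φ.B x y ≠ 0}.ncard := by
  have : Finite V := Module.finite_of_finite K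
  rw [count, count, ← Set.ncard_inter_add_ncard_sdiff_eq_ncard _ {y | Φ.B x y = 0}]
  congr 2
  · ext y
    simp [perp_sup, mem_perp_span_singleton, and_assoc]
  · ext y
    simp [and_assoc]

theorem ncard_perp_add {S : Submodule K V} {x : V} :
    Nat.card (Φ.perp S) = Nat.card (Φ.perp (S ⊔ Submodule.span K {x})) +
      {y | y ∈ Φ.perp S ∧ Φ.B x y ≠ 0}.ncard := by
  have : Finite V := Module.finite_of_finite K
  change (Φ.perp S : Set V).ncard = (Φ.perp (S ⊔ Submodule.span K {x}) : Set V).ncard + _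
  rw [← Set.ncard_inter_add_ncard_sdiff_eq_ncard _ {y | Φ.B x y = 0}]
  congr 2
  ext y
  simp [perp_sup, mem_perp_span_singleton]

/-- The number `q ^ (r + ε - 1)`, written in terms of `h` and the dimension (see `e_eq_rpow`), so
that `-e - 1` is the smallest eigenvalue of the collinearity graph. -/
noncomputable def e : ℝ :=
  Φ.h * (Nat.card K : ℝ) ^ Module.finrank K V / (Nat.card K : ℝ) ^ (𝒬.rank + 2)

omit [FiniteDimensional K V] in
theorem e_pos : 0 < Φ.e := by
  have h0 : (0 : ℝ) < Nat.card K := by exact_mod_cast Nat.card_pos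
  have h1 : (0 : ℝ) < Φ.h := by exact_mod_cast Φ.h_pos
  unfold e
  positivity

theorem count_sub_count {S : Submodule K V} (hS : 𝒬.Contains S) {x : V} (hx : Φ.Sing x)
    (hxp : x ∈ Φ.perp S) (hxS : x ∉ S) {j : ℕ} (hj : Module.finrank K S + j = 𝒬.rank) :
    (Φ.count S : ℝ) - Φ.count (S ⊔ Submodule.span K {x}) =
      Φ.e * ((Nat.card K : ℝ) ^ (j + 1) - (Nat.card K : ℝ) ^ j) := by
  have hq : (0 : ℝ) < Nat.card K := by exact_mod_cast Nat.card_pos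
  have hT : 𝒬.Contains (S ⊔ Submodule.span K {x}) :=
    (Φ.contains_sup_span_singleton_iff hS).2 ⟨hx, hxp⟩
  have h1 := Φ.finrank_perp hS
  have h2 := Φ.finrank_perp hT
  rw [finrank_sup_span_singleton hxS] at h2
  have h3 := Φ.count_eq_add (S := S) (x := x)
  have h4 := Φ.ncard_perp_add (S := S) (x := x)
  have h5 := Φ.card_mul_ncard_sing hx hxp
  rw [Module.natCard_eq_pow_finrank (K := K) (V := Φ.perp S), Module.natCard_eq_pow_finrank
    (K := K) (V := Φ.perp (S ⊔ Submodule.span K {x}))] at h4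
  set m := Module.finrank K (Φ.perp (S ⊔ Submodule.span K {x}))
  set s := Module.finrank K S
  obtain hm : Module.finrank K (Φ.perp S) = m + 1 := by omega
  have hn : Module.finrank K V = s + 1 + m := by omega
  rw [hm] at h4
  have h4' : (Nat.card K : ℝ) ^ (m + 1) = (Nat.card K : ℝ) ^ m +
      ({y | y ∈ Φ.perp S ∧ Φ.B x y ≠ 0}.ncard : ℝ) := by exact_mod_cast h4
  have h5' : (Nat.card K : ℝ) * ({y | Φ.Sing y ∧ y ∈ Φ.perp S ∧ Φ.B x y ≠ 0}.ncard : ℝ) =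
      Φ.h * ({y | y ∈ Φ.perp S ∧ Φ.B x y ≠ 0}.ncard : ℝ) := by exact_mod_cast h5
  have h3' : (Φ.count S : ℝ) - Φ.count (S ⊔ Submodule.span K {x}) =
      ({y | Φ.Sing y ∧ y ∈ Φ.perp S ∧ Φ.B x y ≠ 0}.ncard : ℝ) := by
    rw [h3]; push_cast; ring
  rw [h3', e, hn, ← hj]
  set X := ({y | Φ.Sing y ∧ y ∈ Φ.perp S ∧ Φ.B x y ≠ 0}.ncard : ℝ)
  have h6 : (Nat.card K : ℝ) * X =
      Φ.h * ((Nat.card K : ℝ) ^ (m + 1) - (Nat.card K : ℝ) ^ m) := by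
    rw [h5', h4']; ring
  have h7 : X = Φ.h * ((Nat.card K : ℝ) ^ (m + 1) - (Nat.card K : ℝ) ^ m) / Nat.card K := by
    field_simp
    linarith
  rw [h7]
  field_simp
  ring

/-- The number of singular vectors orthogonal to an `s`-dimensional subspace of the polar space,
where `s + j` is the rank. -/
theorem count_eq {S : Submodule K V} (hS : 𝒬.Contains S) {j : ℕ}
    (hj : Module.finrank K S + j = 𝒬.rank) :
    (Φ.count S : ℝ) = (Nat.card K : ℝ) ^ 𝒬.rank +
      Φ.e * ((Nat.card K : ℝ) ^ (j + 1) - Nat.card K) := by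
  induction j generalizing S with
  | zero =>
    have hset : {x | Φ.Sing x ∧ x ∈ Φ.perp S} = (S : Set V) := by
      ext x
      refine ⟨fun hx => ?_, fun hx => ?_⟩
      · by_contra hxS
        have hmem : Module.finrank K S + 1 ∈ {k | (𝒬.subspaces k).Nonempty} :=
          ⟨_, (Φ.contains_sup_span_singleton_iff hS).2 hx, finrank_sup_span_singleton hxS⟩
        have := 𝒬.isGreatest_rank.2 hmem
        omega
      · exact ⟨(Φ.contains_iff_le_perp.1 hS).1 x hx, (Φ.contains_iff_le_perp.1 hS).2 hx⟩
    have hc : Φ.count S = Nat.card K ^ 𝒬.rank := by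
      rw [count, hset, ← hj, add_zero]
      exact Module.natCard_eq_pow_finrank (K := K) (V := S)
    rw [hc]
    push_cast
    ring
  | succ j ih =>
    obtain ⟨x, hx, hxp, hxS⟩ := Φ.exists_sing_of_finrank_lt hS (by omega)
    have h1 := ih ((Φ.contains_sup_span_singleton_iff hS).2 ⟨hx, hxp⟩)
      (by rw [finrank_sup_span_singleton hxS]; omega)
    have h2 := Φ.count_sub_count hS hx hxp hxS hj
    linear_combination h1 + h2

omit [Finite K] [FiniteDimensional K V] in
/-- For singular vectors `x`, `y` that are not orthogonal, every coset of `⟨x⟩` in the orthogonal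
space of `x` meets the orthogonal space of `y` exactly once. -/
theorem count_sup_of_ne_zero {x y : V} (hx : Φ.Sing x) (hxy : Φ.B x y ≠ 0) :
    Nat.card K * Φ.count (Submodule.span K {x} ⊔ Submodule.span K {y}) =
      Φ.count (Submodule.span K {x}) := by
  have hyx : Φ.B y x ≠ 0 := fun h => hxy (Φ.perp_comm.2 h)
  have hp : ∀ (z : V) (a : K), Φ.Sing z → Φ.B x z = 0 →
      Φ.Sing (z + a • x) ∧ Φ.B x (z + a • x) = 0 := by
    intro z a hz hxz
    refine ⟨Φ.sing_add hz (Φ.sing_smul a hx) ?_, ?_⟩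
    · rw [map_smul, Φ.perp_comm.1 hxz, smul_zero]
    · rw [map_add, map_smul, hxz, Φ.self_eq_zero hx, smul_zero, add_zero]
  have hmem : ∀ z, z ∈ Φ.perp (Submodule.span K {x} ⊔ Submodule.span K {y}) ↔
      Φ.B x z = 0 ∧ Φ.B y z = 0 := by
    intro z
    rw [perp_sup, Submodule.mem_inf, mem_perp_span_singleton, mem_perp_span_singleton]
  have hmem' : ∀ z, z ∈ Φ.perp (Submodule.span K {x}) ↔ Φ.B x z = 0 :=
    fun z => Φ.mem_perp_span_singleton
  let E : ({z // Φ.Sing z ∧ z ∈ Φ.perp (Submodule.span K {x} ⊔ Submodule.span K {y})} × K) ≃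
      {z // Φ.Sing z ∧ z ∈ Φ.perp (Submodule.span K {x})} :=
    { toFun := fun z => ⟨z.1.1 + z.2 • x,
        (hp _ z.2 z.1.2.1 ((hmem _).1 z.1.2.2).1).1,
        (hmem' _).2 (hp _ z.2 z.1.2.1 ((hmem _).1 z.1.2.2).1).2⟩
      invFun := fun w => (⟨w.1 + (-(Φ.B y w.1 / Φ.B y x)) • x,
        (hp _ _ w.2.1 ((hmem' _).1 w.2.2)).1,
        (hmem _).2 ⟨(hp _ _ w.2.1 ((hmem' _).1 w.2.2)).2, by
          rw [map_add, map_smul, smul_eq_mul, neg_mul, div_mul_cancel₀ _ hyx, add_neg_cancel]⟩⟩,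
        Φ.B y w.1 / Φ.B y x)
      left_inv := by
        rintro ⟨⟨z, hz⟩, a⟩
        have ha : Φ.B y (z + a • x) / Φ.B y x = a := by
          rw [map_add, map_smul, ((hmem z).1 hz.2).2, zero_add, smul_eq_mul,
            mul_div_cancel_right₀ _ hyx]
        simp only [ha]
        simp
      right_inv := by rintro ⟨w, hw⟩; simp }
  have h := Nat.card_congr E
  rw [Nat.card_prod] at h
  rw [mul_comm]
  exact h

end Finite

end FormData

end ClassicalPolarSpace

/-! ### Eigenspaces of a matrix satisfying the equation of a strongly regular graph -/

namespace Matrix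

variable {X : Type*} [Fintype X] [DecidableEq X]

/-- The all-ones matrix. -/
local notation "𝟙" => (Matrix.of fun _ _ => 1 : Matrix X X ℝ)

theorem mem_eigenspace_toLin' {C : Matrix X X ℝ} {θ : ℝ} {x : X → ℝ} :
    x ∈ Module.End.eigenspace (Matrix.toLin' C) θ ↔ C *ᵥ x = θ • x := by
  rw [Module.End.mem_eigenspace_iff, Matrix.toLin'_apply]

omit [DecidableEq X] in
theorem allOnes_mul_allOnes : 𝟙 * 𝟙 = (Fintype.card X : ℝ) • 𝟙 := by
  ext i j
  simp [Matrix.mul_apply]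

theorem card_mul_eq_of_sq_eq [Nonempty X] {C : Matrix X X ℝ} {a b c κ : ℝ}
    (hC : C * C = (a + b) • C - (a * b) • 1 + c • 𝟙) (hCJ : C * 𝟙 = κ • 𝟙) :
    c * Fintype.card X = (κ - a) * (κ - b) := by
  have h : C * C * 𝟙 = (κ * κ) • 𝟙 := by
    rw [mul_assoc, hCJ, Matrix.mul_smul, hCJ, smul_smul]
  rw [hC, add_mul, sub_mul, smul_mul, smul_mul, smul_mul, one_mul, hCJ, allOnes_mul_allOnes] at h
  obtain ⟨i⟩ := ‹Nonempty X›
  have h' := congrFun (congrFun h i) i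
  simp only [add_apply, sub_apply, smul_apply, of_apply, smul_eq_mul, mul_one] at h'
  linear_combination h'

omit [DecidableEq X] in
/-- Eigenvectors for an eigenvalue other than the row sum `κ` are orthogonal to the constants. -/
theorem allOnes_mulVec_eq_zero {C : Matrix X X ℝ} {κ θ : ℝ} (hJC : 𝟙 * C = κ • 𝟙)
    (hθ : κ ≠ θ) {x : X → ℝ} (hx : C *ᵥ x = θ • x) : 𝟙 *ᵥ x = 0 := by
  have h : (𝟙 * C) *ᵥ x = θ • (𝟙 *ᵥ x) := by
    rw [← mulVec_mulVec, hx, mulVec_smul]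
  rw [hJC, smul_mulVec, ← sub_eq_zero, ← sub_smul] at h
  exact (smul_eq_zero.1 h).resolve_left (sub_ne_zero.2 hθ)

/-- The matrix has no eigenvalues besides `κ`, `a` and `b`. -/
theorem eigenspace_eq_bot_of_sq_eq {C : Matrix X X ℝ} {a b c κ θ : ℝ}
    (hC : C * C = (a + b) • C - (a * b) • 1 + c • 𝟙) (hJC : 𝟙 * C = κ • 𝟙)
    (hκ : κ ≠ θ) (ha : θ ≠ a) (hb : θ ≠ b) :
    Module.End.eigenspace (Matrix.toLin' C) θ = ⊥ := by
  rw [eq_bot_iff]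
  intro x hx
  rw [mem_eigenspace_toLin'] at hx
  have h0 := allOnes_mulVec_eq_zero hJC hκ hx
  have h : (C * C) *ᵥ x = (θ * θ) • x := by
    rw [← mulVec_mulVec, hx, mulVec_smul, hx, smul_smul]
  rw [hC, add_mulVec, sub_mulVec, smul_mulVec, smul_mulVec, smul_mulVec, h0, one_mulVec, hx,
    smul_zero, add_zero, smul_smul, ← sub_smul, ← sub_eq_zero, ← sub_smul] at h
  refine (smul_eq_zero.1 h).resolve_left ?_
  have : (a + b) * θ - a * b - θ * θ = -((θ - a) * (θ - b)) := by ring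
  rw [this]
  exact neg_ne_zero.2 (mul_ne_zero (sub_ne_zero.2 ha) (sub_ne_zero.2 hb))

/-- The dimension of the eigenspace for `a`, computed as the trace of the projection
`(C - b - (κ - b) / v • 𝟙) / (a - b)` onto it, where `v` is the number of rows. -/
theorem finrank_eigenspace_of_sq_eq [Nonempty X] {C : Matrix X X ℝ} {a b c κ : ℝ}
    (hC : C * C = (a + b) • C - (a * b) • 1 + c • 𝟙) (hCJ : C * 𝟙 = κ • 𝟙)
    (hJC : 𝟙 * C = κ • 𝟙) (hab : a ≠ b) (hκ : κ ≠ a) :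
    (Module.finrank ℝ (Module.End.eigenspace (Matrix.toLin' C) a) : ℝ) * (a - b) =
      C.trace - κ - b * (Fintype.card X - 1) := by
  have hv : (Fintype.card X : ℝ) ≠ 0 := by exact_mod_cast Fintype.card_ne_zero
  have hab' := sub_ne_zero.2 hab
  have hc := card_mul_eq_of_sq_eq hC hCJ
  let E : Matrix X X ℝ :=
    (a - b)⁻¹ • (C - b • 1 - ((κ - b) / Fintype.card X) • 𝟙)
  have hproj : LinearMap.IsProj (Module.End.eigenspace (Matrix.toLin' C) a) (Matrix.toLin' E) := by
    constructor
    · intro x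
      rw [mem_eigenspace_toLin', toLin'_apply, mulVec_mulVec, ← smul_mulVec]
      congr 1
      have hc' : c = (κ - a) * ((κ - b) / Fintype.card X) := by
        field_simp
        exact hc
      simp only [E, Matrix.mul_smul, mul_sub, hC, hCJ, mul_one, hc']
      ext i j
      simp only [smul_apply, sub_apply, add_apply, smul_eq_mul]
      ring
    · intro x hx
      rw [mem_eigenspace_toLin'] at hx
      have h0 := allOnes_mulVec_eq_zero hJC hκ hx
      rw [toLin'_apply, smul_mulVec, sub_mulVec, sub_mulVec, smul_mulVec, smul_mulVec, h0, hx,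
        one_mulVec, smul_zero, sub_zero, ← sub_smul, smul_smul, inv_mul_cancel₀ hab', one_smul]
  have ht := hproj.trace
  rw [Matrix.trace_toLin'_eq] at ht
  rw [← ht]
  simp only [E, trace_smul, trace_sub, trace_one, smul_eq_mul]
  have hJ : trace 𝟙 = Fintype.card X := by simp [trace]
  rw [hJ]
  field_simp
  ring

/-- The rank of a combination of `1` and `C`, in terms of an eigenspace of `C`. -/
theorem rank_smul_add_finrank_eigenspace {C M : Matrix X X ℝ} {l θ : ℝ} (hl : l ≠ 0)
    (hM : M = l • (C - θ • 1)) :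
    M.rank + Module.finrank ℝ (Module.End.eigenspace (Matrix.toLin' C) θ) = Fintype.card X := by
  have hker : LinearMap.ker M.mulVecLin = Module.End.eigenspace (Matrix.toLin' C) θ := by
    ext x
    rw [mem_eigenspace_toLin', LinearMap.mem_ker, mulVecLin_apply, hM, smul_mulVec,
      smul_eq_zero_iff_right hl, sub_mulVec, smul_mulVec, one_mulVec, sub_eq_zero]
  rw [← hker, Matrix.rank, LinearMap.finrank_range_add_finrank_ker,
    Module.finrank_fintype_fun_eq_card]

end Matrix

/-! ### The collinearity graph -/

namespace ClassicalPolarSpace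

namespace FormData

variable {K : Type u} {V : Type v} [Field K] [AddCommGroup V] [Module K V]
  {𝒬 : ClassicalPolarSpace K V} (Φ : FormData 𝒬) [Finite K] [FiniteDimensional K V]

omit [Finite K] [FiniteDimensional K V] in
theorem span_singleton_eq_point (P : 𝒬.Point) {x : V} (hx : x ∈ (P : Submodule K V))
    (hx0 : x ≠ 0) : Submodule.span K {x} = P := by
  have : FiniteDimensional K (P : Submodule K V) :=
    Module.finite_of_finrank_pos (by rw [P.2.2]; exact one_pos)
  refine Submodule.eq_of_le_of_finrank_eq ?_ ?_
  · rwa [Submodule.span_singleton_le_iff_mem]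
  · rw [finrank_span_singleton hx0, P.2.2]

theorem card_points_perp (W : Submodule K V) :
    ((Nat.card K : ℝ) - 1) * Nat.card {R : 𝒬.Point // (R : Submodule K V) ≤ Φ.perp W} + 1 =
      Φ.count W := by
  have : Finite V := Module.finite_of_finite K
  have := Fintype.ofFinite {R : 𝒬.Point // (R : Submodule K V) ≤ Φ.perp W}
  let F : (Σ R : {R : 𝒬.Point // (R : Submodule K V) ≤ Φ.perp W},
      (((R.1 : Submodule K V) : Set V) \ {0} : Set V)) →
      ({x | Φ.Sing x ∧ x ∈ Φ.perp W} \ {0} : Set V) :=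
    fun z => ⟨z.2.1, ⟨(Φ.contains_iff_le_perp.1 z.1.1.2.1).1 _ z.2.2.1, z.1.2 z.2.2.1⟩, z.2.2.2⟩
  have hF : Function.Bijective F := by
    constructor
    · rintro ⟨⟨R, hR⟩, ⟨x, hx⟩⟩ ⟨⟨R', hR'⟩, ⟨x', hx'⟩⟩ h
      obtain rfl : x = x' := congrArg Subtype.val h
      obtain rfl : R = R' := Subtype.ext
        ((span_singleton_eq_point R hx.1 hx.2).symm.trans (span_singleton_eq_point R' hx'.1 hx'.2))
      rfl
    · rintro ⟨x, ⟨hx, hxW⟩, hx0⟩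
      refine ⟨⟨⟨⟨Submodule.span K {x}, Φ.contains_span_singleton.2 hx,
        finrank_span_singleton hx0⟩, ?_⟩, ⟨x, Submodule.mem_span_singleton_self x, hx0⟩⟩, rfl⟩
      rwa [Submodule.span_singleton_le_iff_mem]
  have h := Nat.card_congr (Equiv.ofBijective F hF)
  have hfib : ∀ R : {R : 𝒬.Point // (R : Submodule K V) ≤ Φ.perp W},
      Nat.card (((R.1 : Submodule K V) : Set V) \ {0} : Set V) = Nat.card K - 1 := by
    intro R
    have h1 := Set.ncard_sdiff_singleton_of_mem (R.1 : Submodule K V).zero_mem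
    have h2 := Module.natCard_eq_pow_finrank (K := K) (V := (R.1 : Submodule K V))
    rw [R.1.2.2, pow_one] at h2
    rw [← h2]
    exact h1
  rw [Nat.card_sigma, Finset.sum_congr rfl (fun R _ => hfib R), Finset.sum_const,
    Finset.card_univ, smul_eq_mul, ← Nat.card_eq_fintype_card] at h
  have h0 : (0 : V) ∈ {x | Φ.Sing x ∧ x ∈ Φ.perp W} := ⟨Φ.sing_zero, (Φ.perp W).zero_mem⟩
  have h1 : Nat.card ({x | Φ.Sing x ∧ x ∈ Φ.perp W} \ {0} : Set V) + 1 = Φ.count W :=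
    Set.ncard_sdiff_singleton_add_one h0
  rw [← h1, ← h]
  push_cast [Nat.cast_sub (Finite.one_lt_card (α := K)).le]
  ring

open Classical in
/-- The matrix of the relation of being equal or collinear. -/
noncomputable def collinMatrix : Matrix 𝒬.Point 𝒬.Point ℝ :=
  Matrix.of fun P R => if (R : Submodule K V) ≤ Φ.perp P then 1 else 0

omit [Finite K] [FiniteDimensional K V] in
open Classical in
theorem adjMatrix_add_one : 𝒬.collinearityGraph.adjMatrix ℝ + 1 = Φ.collinMatrix := by
  ext P R
  rw [Matrix.add_apply, SimpleGraph.adjMatrix_apply, collinMatrix, Matrix.of_apply]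
  by_cases h : P = R
  · subst h
    simp [(Φ.contains_iff_le_perp.1 P.2.1).2]
  · rw [Matrix.one_apply_ne h, add_zero]
    refine if_congr ?_ rfl rfl
    change P ≠ R ∧ _ ↔ _
    rw [Φ.contains_sup_iff P.2.1 R.2.1]
    exact and_iff_right h

open Classical in
theorem eigenvalueMultiplicity_eq (θ : ℝ) : 𝒬.eigenvalueMultiplicity θ =
    Module.finrank ℝ (Module.End.eigenspace (Matrix.toLin' Φ.collinMatrix) (θ + 1)) := by
  have h : Module.End.eigenspace (Matrix.toLin' (𝒬.collinearityGraph.adjMatrix ℝ)) θ =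
      Module.End.eigenspace (Matrix.toLin' Φ.collinMatrix) (θ + 1) := by
    ext x
    rw [Matrix.mem_eigenspace_toLin', Matrix.mem_eigenspace_toLin', ← adjMatrix_add_one,
      Matrix.add_mulVec, Matrix.one_mulVec, add_smul, one_smul, add_left_inj]
  rw [eigenvalueMultiplicity, h]

open Classical in
theorem trace_collinMatrix : Φ.collinMatrix.trace = Fintype.card 𝒬.Point := by
  rw [Matrix.trace, Finset.sum_congr rfl (g := fun _ => (1 : ℝ))]
  · simp
  · intro P _
    rw [Matrix.diag_apply, collinMatrix, Matrix.of_apply,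
      if_pos (Φ.contains_iff_le_perp.1 P.2.1).2]

omit [Finite K] [FiniteDimensional K V] in
open Classical in
theorem isSymm_collinMatrix : Φ.collinMatrix.transpose = Φ.collinMatrix := by
  ext P R
  rw [Matrix.transpose_apply, collinMatrix, Matrix.of_apply, Matrix.of_apply]
  exact if_congr Φ.le_perp_comm rfl rfl

open Classical in
theorem sum_points_perp (W : Submodule K V) :
    ((Nat.card K : ℝ) - 1) *
      (∑ R : 𝒬.Point, if (R : Submodule K V) ≤ Φ.perp W then (1 : ℝ) else 0) =
      Φ.count W - 1 := by
  rw [← Φ.card_points_perp W, Finset.sum_boole, Nat.card_eq_fintype_card (α := {R : 𝒬.Point // _}),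
    Fintype.card_subtype]
  ring

theorem q_sub_one_pos : (0 : ℝ) < (Nat.card K : ℝ) - 1 := by
  rw [sub_pos]
  exact_mod_cast Finite.one_lt_card (α := K)

theorem card_points :
    ((Nat.card K : ℝ) - 1) * Fintype.card 𝒬.Point =
      ((Nat.card K : ℝ) ^ 𝒬.rank - 1) * (1 + Φ.e * Nat.card K) := by
  have h1 := Φ.sum_points_perp ⊥
  have h2 := Φ.count_eq (Φ.contains_mono bot_le (𝒬.isGreatest_rank.1.choose_spec.1) :
    𝒬.Contains ⊥) (j := 𝒬.rank) (by simp)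
  rw [h2] at h1
  simp only [perp_bot, le_top, if_true, Finset.sum_const, Finset.card_univ, nsmul_eq_mul,
    mul_one] at h1
  rw [h1]
  ring

/-- One more than the valency of the collinearity graph. -/
noncomputable def κ : ℝ :=
  ((Nat.card K : ℝ) ^ 𝒬.rank + Φ.e * ((Nat.card K : ℝ) ^ 𝒬.rank - Nat.card K) - 1) /
    ((Nat.card K : ℝ) - 1)

theorem count_point {j : ℕ} (hj : 𝒬.rank = j + 1) (P : 𝒬.Point) :
    (Φ.count P : ℝ) = (Nat.card K : ℝ) ^ 𝒬.rank +
      Φ.e * ((Nat.card K : ℝ) ^ 𝒬.rank - Nat.card K) := by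
  rw [Φ.count_eq P.2.1 (j := j) (by rw [P.2.2, hj, add_comm]), hj]

theorem collinMatrix_mul_allOnes {j : ℕ} (hj : 𝒬.rank = j + 1) :
    Φ.collinMatrix * (Matrix.of fun _ _ => 1) = Φ.κ • Matrix.of fun _ _ => 1 := by
  ext P R
  have h := Φ.sum_points_perp P
  rw [Φ.count_point hj] at h
  simp only [Matrix.mul_apply, collinMatrix, Matrix.of_apply, mul_one, Matrix.smul_apply,
    smul_eq_mul, κ]
  rw [eq_div_iff (q_sub_one_pos (K := K)).ne', mul_comm]
  exact h

theorem allOnes_mul_collinMatrix {j : ℕ} (hj : 𝒬.rank = j + 1) :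
    (Matrix.of fun _ _ => 1) * Φ.collinMatrix = Φ.κ • Matrix.of fun _ _ => 1 := by
  have h := congrArg Matrix.transpose (Φ.collinMatrix_mul_allOnes hj)
  rw [Matrix.transpose_mul, isSymm_collinMatrix] at h
  exact h

open Classical in
/-- The collinearity graph is strongly regular: the number of points collinear with two given points
depends only on whether these are equal, collinear or neither. The coefficients are arranged to show
the roots `q ^ (r - 1)` and `-e` of the resulting quadratic equation. -/
theorem collinMatrix_mul_self {j : ℕ} (hj : 𝒬.rank = j + 2) :
    ∃ c : ℝ, Φ.collinMatrix * Φ.collinMatrix =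
      ((Nat.card K : ℝ) ^ (j + 1) + -Φ.e) • Φ.collinMatrix -
        ((Nat.card K : ℝ) ^ (j + 1) * -Φ.e) • 1 + c • Matrix.of fun _ _ => 1 := by
  have hq1 := (q_sub_one_pos (K := K)).ne'
  have hq : (Nat.card K : ℝ) ≠ 0 := by exact_mod_cast Nat.card_pos.ne'
  -- The entry at two points that are not collinear.
  refine ⟨(((Nat.card K : ℝ) ^ (j + 1) + Φ.e * ((Nat.card K : ℝ) ^ (j + 1) - 1)) - 1) /
    ((Nat.card K : ℝ) - 1), ?_⟩
  ext P R
  have hentry : ((Nat.card K : ℝ) - 1) * (Φ.collinMatrix * Φ.collinMatrix) P R =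
      Φ.count ((P : Submodule K V) ⊔ R) - 1 := by
    rw [← sum_points_perp, Matrix.mul_apply]
    congr 1
    refine Finset.sum_congr rfl fun T _ => ?_
    simp only [collinMatrix, Matrix.of_apply, perp_sup, le_inf_iff, ite_and, mul_ite, mul_one,
      mul_zero, Φ.le_perp_comm (U := (R : Submodule K V))]
    split_ifs <;> rfl
  apply mul_left_cancel₀ hq1
  rw [hentry]
  simp only [Matrix.add_apply, Matrix.sub_apply, Matrix.smul_apply, Matrix.of_apply, smul_eq_mul,
    mul_one]
  by_cases hPR : P = R
  · subst hPR
    have hC : Φ.collinMatrix P P = 1 := by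
      rw [collinMatrix, Matrix.of_apply, if_pos (Φ.contains_iff_le_perp.1 P.2.1).2]
    rw [sup_idem, Φ.count_point (j := j + 1) hj, hC, Matrix.one_apply_eq, hj]
    field_simp
    ring
  · rw [Matrix.one_apply_ne hPR]
    obtain ⟨x, hxP, hx0⟩ := Submodule.exists_mem_ne_zero_of_ne_bot (p := (P : Submodule K V))
      (fun h => by have := P.2.2; rw [h, finrank_bot] at this; omega)
    obtain ⟨y, hyR, hy0⟩ := Submodule.exists_mem_ne_zero_of_ne_bot (p := (R : Submodule K V))
      (fun h => by have := R.2.2; rw [h, finrank_bot] at this; omega)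
    have hP := span_singleton_eq_point P hxP hx0
    have hR := span_singleton_eq_point R hyR hy0
    by_cases hperp : (R : Submodule K V) ≤ Φ.perp P
    · have hC : Φ.collinMatrix P R = 1 := by
        rw [collinMatrix, Matrix.of_apply, if_pos hperp]
      have hyP : y ∉ (P : Submodule K V) := fun h => hPR (Subtype.ext
        ((span_singleton_eq_point P h hy0).symm.trans hR))
      have hfin : Module.finrank K ((P : Submodule K V) ⊔ R : Submodule K V) = 2 := by
        rw [← hR, finrank_sup_span_singleton hyP, P.2.2]
      rw [Φ.count_eq ((Φ.contains_sup_iff P.2.1 R.2.1).2 hperp) (j := j) (by rw [hfin, hj]; ring),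
        hC, hj]
      field_simp
      ring
    · have hC : Φ.collinMatrix P R = 0 := by
        rw [collinMatrix, Matrix.of_apply, if_neg hperp]
      have hxy : Φ.B x y ≠ 0 := by
        rwa [← hR, Submodule.span_singleton_le_iff_mem, ← hP, mem_perp_span_singleton] at hperp
      have h := Φ.count_sup_of_ne_zero (Φ.contains_span_singleton.1 (hP ▸ P.2.1)) hxy
      rw [hP, hR] at h
      have h' : (Nat.card K : ℝ) * Φ.count ((P : Submodule K V) ⊔ R) = Φ.count P := by
        exact_mod_cast h
      rw [Φ.count_point (j := j + 1) hj, hj] at h'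
      rw [hC]
      field_simp
      apply mul_left_cancel₀ hq
      linear_combination h'

/-! ### Multiplicities of the eigenvalues -/

omit [FiniteDimensional K V] in
theorem pow_lt_κ {j : ℕ} (hj : 𝒬.rank = j + 2) : (Nat.card K : ℝ) ^ (j + 1) < Φ.κ := by
  have h1 := q_sub_one_pos (K := K)
  have hq : (1 : ℝ) < Nat.card K := sub_pos.1 h1
  have h2 : 1 < (Nat.card K : ℝ) ^ (j + 1) := one_lt_pow₀ hq (by omega)
  have h3 : (Nat.card K : ℝ) < (Nat.card K : ℝ) ^ (j + 2) := by
    rw [pow_succ]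
    nlinarith
  rw [κ, lt_div_iff₀ h1, hj]
  have h4 := mul_pos Φ.e_pos (sub_pos.2 h3)
  have h5 : (Nat.card K : ℝ) ^ (j + 2) = (Nat.card K : ℝ) ^ (j + 1) * Nat.card K := pow_succ _ _
  nlinarith

omit [FiniteDimensional K V] in
theorem κ_mul : Φ.κ * ((Nat.card K : ℝ) - 1) =
    (Nat.card K : ℝ) ^ 𝒬.rank + Φ.e * ((Nat.card K : ℝ) ^ 𝒬.rank - Nat.card K) - 1 :=
  div_mul_cancel₀ _ (q_sub_one_pos (K := K)).ne'

include Φ in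
theorem nonempty_point {j : ℕ} (hj : 𝒬.rank = j + 1) : Nonempty 𝒬.Point := by
  by_contra h
  rw [not_nonempty_iff] at h
  have h1 := Φ.card_points
  rw [Fintype.card_eq_zero, Nat.cast_zero, mul_zero, hj] at h1
  have hq : (1 : ℝ) < Nat.card K := sub_pos.1 q_sub_one_pos
  have h2 : 1 < (Nat.card K : ℝ) ^ (j + 1) := one_lt_pow₀ hq (by omega)
  have h3 : 0 < Φ.e * Nat.card K := mul_pos Φ.e_pos (by linarith)
  have h4 := mul_pos (sub_pos.2 h2) (by linarith : 0 < 1 + Φ.e * Nat.card K)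
  linarith

open Classical in
theorem m₁_mul {j : ℕ} (hj : 𝒬.rank = j + 2) :
    (𝒬.m₁ : ℝ) * ((Nat.card K : ℝ) ^ (j + 1) + Φ.e) =
      Fintype.card 𝒬.Point - Φ.κ + Φ.e * (Fintype.card 𝒬.Point - 1) := by
  have := Φ.nonempty_point (j := j + 1) hj
  have hq : (0 : ℝ) < Nat.card K := by exact_mod_cast Nat.card_pos
  obtain ⟨c, hc⟩ := Φ.collinMatrix_mul_self hj
  have h := Matrix.finrank_eigenspace_of_sq_eq hc (Φ.collinMatrix_mul_allOnes (j := j + 1) hj)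
    (Φ.allOnes_mul_collinMatrix (j := j + 1) hj)
    (by have := Φ.e_pos; have := pow_pos hq (j + 1); linarith) (Φ.pow_lt_κ hj).ne'
  rw [Φ.trace_collinMatrix] at h
  rw [m₁, Φ.eigenvalueMultiplicity_eq, sub_add_cancel, show 𝒬.rank - 1 = j + 1 by omega]
  convert h using 1 <;> ring

theorem m₁_eq {j : ℕ} (hj : 𝒬.rank = j + 2) :
    (𝒬.m₁ : ℝ) = Φ.e * Nat.card K * (Φ.e + 1) / ((Nat.card K : ℝ) ^ (j + 1) + Φ.e) *
      (((Nat.card K : ℝ) ^ 𝒬.rank - 1) / ((Nat.card K : ℝ) - 1)) := by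
  have h1 := q_sub_one_pos (K := K)
  have h2 : 0 < (Nat.card K : ℝ) ^ (j + 1) + Φ.e :=
    add_pos (pow_pos (by linarith) _) Φ.e_pos
  have h3 := Φ.m₁_mul hj
  have h4 := Φ.card_points
  have h5 := Φ.κ_mul
  rw [div_mul_div_comm, eq_div_iff (mul_pos h2 h1).ne']
  linear_combination ((Nat.card K : ℝ) - 1) * h3 + (1 + Φ.e) * h4 - h5

open Classical in
/-- The eigenspace for the smallest eigenvalue complements those for `κ` and `q ^ (r - 1)`. -/
theorem finrank_eigenspace_neg_e {j : ℕ} (hj : 𝒬.rank = j + 2) :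
    (Module.finrank ℝ (Module.End.eigenspace (Matrix.toLin' Φ.collinMatrix) (-Φ.e)) : ℝ) =
      Fintype.card 𝒬.Point - 1 - 𝒬.m₁ := by
  have := Φ.nonempty_point (j := j + 1) hj
  have hq : (0 : ℝ) < Nat.card K := by exact_mod_cast Nat.card_pos
  have hpos := pow_pos hq (j + 1)
  have he := Φ.e_pos
  obtain ⟨c, hc⟩ := Φ.collinMatrix_mul_self hj
  rw [add_comm ((Nat.card K : ℝ) ^ (j + 1)), mul_comm ((Nat.card K : ℝ) ^ (j + 1))] at hc
  have h := Matrix.finrank_eigenspace_of_sq_eq hc (Φ.collinMatrix_mul_allOnes (j := j + 1) hj)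
    (Φ.allOnes_mul_collinMatrix (j := j + 1) hj) (by linarith)
    (by have := Φ.pow_lt_κ hj; linarith)
  rw [Φ.trace_collinMatrix] at h
  have h3 := Φ.m₁_mul hj
  apply mul_right_cancel₀ (b := (Nat.card K : ℝ) ^ (j + 1) + Φ.e) (by linarith)
  linear_combination -h + h3

open Classical in
theorem finrank_eigenspace_of_lt_neg_e {j : ℕ} (hj : 𝒬.rank = j + 2) {θ : ℝ} (hθ : θ < -Φ.e) :
    Module.finrank ℝ (Module.End.eigenspace (Matrix.toLin' Φ.collinMatrix) θ) = 0 := by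
  have hq : (0 : ℝ) < Nat.card K := by exact_mod_cast Nat.card_pos
  have hpos := pow_pos hq (j + 1)
  have he := Φ.e_pos
  obtain ⟨c, hc⟩ := Φ.collinMatrix_mul_self hj
  have hκ := Φ.pow_lt_κ hj
  rw [Matrix.eigenspace_eq_bot_of_sq_eq hc (Φ.allOnes_mul_collinMatrix (j := j + 1) hj)
    (by linarith) (by linarith) (by linarith), finrank_bot]

end FormData

end ClassicalPolarSpace

/-! ### Designs -/

namespace ClassicalPolarSpace

namespace FormData

variable {K : Type u} {V : Type v} [Field K] [AddCommGroup V] [Module K V]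
  {𝒬 : ClassicalPolarSpace K V} (Φ : FormData 𝒬) [Finite K] [FiniteDimensional K V]

/-- Double counting of the pairs `(x, B)` of a vector outside a fixed `s`-dimensional subspace `S`
and a block `B` containing `S` and `x`. -/
theorem ncard_blocks_mul {D : Set (Submodule K V)} {k : ℕ} (hD : D ⊆ 𝒬.subspaces k) {s : ℕ}
    {l : ℕ} (hl : ∀ T ∈ 𝒬.subspaces (s + 1), {B | B ∈ D ∧ T ≤ B}.ncard = l)
    {S : Submodule K V} (hS : S ∈ 𝒬.subspaces s) :
    ({B | B ∈ D ∧ S ≤ B}.ncard : ℝ) * ((Nat.card K : ℝ) ^ k - (Nat.card K : ℝ) ^ s) =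
      (Φ.count S - (Nat.card K : ℝ) ^ s) * l := by
  classical
  have : Finite V := Module.finite_of_finite K
  have hqs : ∀ (U : Submodule K V), ((U : Set V).ncard : ℝ) =
      (Nat.card K : ℝ) ^ Module.finrank K U := fun U => by
    exact_mod_cast Module.natCard_eq_pow_finrank (K := K) (V := U)
  let E : (Σ B : {B | B ∈ D ∧ S ≤ B}, ((B.1 : Set V) \ S : Set V)) ≃
      Σ x : ({x | Φ.Sing x ∧ x ∈ Φ.perp S} \ S : Set V),
        {B | B ∈ D ∧ S ⊔ Submodule.span K {x.1} ≤ B} :=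
    { toFun := fun z => ⟨⟨z.2.1, (Φ.contains_sup_span_singleton_iff hS.1).1
          (Φ.contains_mono (sup_le z.1.2.2 ((Submodule.span_singleton_le_iff_mem _ _).2 z.2.2.1))
            (hD z.1.2.1).1), z.2.2.2⟩,
        ⟨z.1.1, z.1.2.1, sup_le z.1.2.2 ((Submodule.span_singleton_le_iff_mem _ _).2 z.2.2.1)⟩⟩
      invFun := fun z => ⟨⟨z.2.1, z.2.2.1, le_sup_left.trans z.2.2.2⟩, ⟨z.1.1,
        (Submodule.span_singleton_le_iff_mem _ _).1 (le_sup_right.trans z.2.2.2), z.1.2.2⟩⟩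
      left_inv := fun _ => rfl
      right_inv := fun _ => rfl }
  have := Fintype.ofFinite {B | B ∈ D ∧ S ≤ B}
  have := Fintype.ofFinite ({x | Φ.Sing x ∧ x ∈ Φ.perp S} \ S : Set V)
  have h : (Nat.card (Σ B : {B | B ∈ D ∧ S ≤ B}, ((B.1 : Set V) \ S : Set V)) : ℝ) = Nat.card
      (Σ x : ({x | Φ.Sing x ∧ x ∈ Φ.perp S} \ S : Set V),
        {B | B ∈ D ∧ S ⊔ Submodule.span K {x.1} ≤ B}) := by rw [Nat.card_congr E]
  rw [Nat.card_sigma, Nat.card_sigma, Nat.cast_sum, Nat.cast_sum] at h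
  have h1 : ∀ B : {B | B ∈ D ∧ S ≤ B}, (Nat.card ((B.1 : Set V) \ S : Set V) : ℝ) =
      (Nat.card K : ℝ) ^ k - (Nat.card K : ℝ) ^ s := by
    intro B
    have hle : (S : Set V) ⊆ (B.1 : Set V) := B.2.2
    have h2 := Set.ncard_sdiff_add_ncard_of_subset hle
    have h3 := hqs B.1
    have h4 := hqs S
    rw [← h2, (hD B.2.1).2] at h3
    rw [hS.2] at h4
    push_cast at h3
    rw [← h3, ← h4, add_sub_cancel_right]
    rfl
  have h2 : ∀ x : ({x | Φ.Sing x ∧ x ∈ Φ.perp S} \ S : Set V),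
      (Nat.card {B | B ∈ D ∧ S ⊔ Submodule.span K {x.1} ≤ B} : ℝ) = l := by
    intro x
    exact_mod_cast hl _ ⟨(Φ.contains_sup_span_singleton_iff hS.1).2 x.2.1, by
      rw [finrank_sup_span_singleton x.2.2, hS.2]⟩
  rw [Finset.sum_congr rfl (fun B _ => h1 B), Finset.sum_congr rfl (fun x _ => h2 x),
    Finset.sum_const, Finset.sum_const, Finset.card_univ, Finset.card_univ, nsmul_eq_mul,
    nsmul_eq_mul, ← Nat.card_eq_fintype_card, ← Nat.card_eq_fintype_card] at h
  have hle : (S : Set V) ⊆ {x | Φ.Sing x ∧ x ∈ Φ.perp S} := fun x hx =>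
    ⟨(Φ.contains_iff_le_perp.1 hS.1).1 x hx, (Φ.contains_iff_le_perp.1 hS.1).2 hx⟩
  have h3 : (Φ.count S : ℝ) - (Nat.card K : ℝ) ^ s =
      Nat.card ({x | Φ.Sing x ∧ x ∈ Φ.perp S} \ S : Set V) := by
    have h4 := hqs S
    rw [hS.2] at h4
    rw [count, ← Set.ncard_sdiff_add_ncard_of_subset hle, ← h4]
    push_cast
    rw [add_sub_cancel_right]
    rfl
  rw [h3]
  exact h

theorem count_sub_pow {s j : ℕ} (hj : s + j = 𝒬.rank) {S : Submodule K V}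
    (hS : S ∈ 𝒬.subspaces s) : (Φ.count S : ℝ) - (Nat.card K : ℝ) ^ s =
      ((Nat.card K : ℝ) ^ j - 1) * ((Nat.card K : ℝ) ^ s + Φ.e * Nat.card K) := by
  rw [Φ.count_eq hS.1 (by rw [hS.2, hj]), ← hj]
  ring

include Φ in
/-- A design is also a design for all smaller strengths, with a positive number of blocks on each
subspace. -/
theorem exists_ncard_blocks_eq {D : Set (Submodule K V)} {k t lam : ℕ}
    (hD : 𝒬.IsDesign t k lam D) (hlam : 1 ≤ lam) (htk : t ≤ k) (i : ℕ) (hi : i ≤ t) :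
    ∃ l : ℕ, 0 < l ∧ ∀ T ∈ 𝒬.subspaces (t - i), {B | B ∈ D ∧ T ≤ B}.ncard = l := by
  induction i with
  | zero => exact ⟨lam, hlam, hD.ncard_eq⟩
  | succ i ih =>
    obtain ⟨l, hl0, hl⟩ := ih (by omega)
    obtain ⟨s, hs⟩ : ∃ s, t - i = s + 1 := ⟨t - (i + 1), by omega⟩
    rw [show t - (i + 1) = s by omega]
    rw [hs] at hl
    have hq : (1 : ℝ) < Nat.card K := sub_pos.1 q_sub_one_pos
    have hpos : 0 < (Nat.card K : ℝ) ^ k - (Nat.card K : ℝ) ^ s :=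
      sub_pos.2 (pow_lt_pow_right₀ hq (by omega))
    obtain ⟨j, hj⟩ : ∃ j, s + (j + 1) = 𝒬.rank := ⟨𝒬.rank - (s + 1), by have := hD.t_le; omega⟩
    have key : ∀ S ∈ 𝒬.subspaces s, ({B | B ∈ D ∧ S ≤ B}.ncard : ℝ) =
        ((Nat.card K : ℝ) ^ (j + 1) - 1) * ((Nat.card K : ℝ) ^ s + Φ.e * Nat.card K) * l /
          ((Nat.card K : ℝ) ^ k - (Nat.card K : ℝ) ^ s) := by
      intro S hS
      rw [eq_div_iff hpos.ne', Φ.ncard_blocks_mul hD.subset hl hS, Φ.count_sub_pow hj hS]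
    obtain ⟨S, hS⟩ := Φ.subspaces_nonempty (s := s) (by omega)
    refine ⟨{B | B ∈ D ∧ S ≤ B}.ncard, ?_, fun T hT => ?_⟩
    · have h := key S hS
      have h1 : 1 < (Nat.card K : ℝ) ^ (j + 1) := one_lt_pow₀ hq (by omega)
      have h2 := Φ.e_pos
      have h3 : (0 : ℝ) < l := by exact_mod_cast hl0
      have h4 : 0 < (Nat.card K : ℝ) ^ (j + 1) - 1 := sub_pos.2 h1
      have h5 : (0 : ℝ) < {B | B ∈ D ∧ S ≤ B}.ncard := by
        rw [h]
        positivity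
      exact_mod_cast h5
    · have h : ({B | B ∈ D ∧ T ≤ B}.ncard : ℝ) = {B | B ∈ D ∧ S ≤ B}.ncard := by
        rw [key T hT, key S hS]
      exact_mod_cast h

open Classical in
theorem incidenceMatrix_mul_transpose {D : Set (Submodule K V)} {k : ℕ}
    (hD : D ⊆ 𝒬.subspaces k) {l₁ l₂ : ℕ}
    (h₁ : ∀ T ∈ 𝒬.subspaces 1, {B | B ∈ D ∧ T ≤ B}.ncard = l₁)
    (h₂ : ∀ T ∈ 𝒬.subspaces 2, {B | B ∈ D ∧ T ≤ B}.ncard = l₂) :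
    𝒬.incidenceMatrix D * (𝒬.incidenceMatrix D).transpose =
      (l₁ : ℝ) • 1 + (l₂ : ℝ) • (Φ.collinMatrix - 1) := by
  ext P R
  have hentry : (𝒬.incidenceMatrix D * (𝒬.incidenceMatrix D).transpose) P R =
      {B | B ∈ D ∧ (P : Submodule K V) ⊔ R ≤ B}.ncard := by
    rw [Matrix.mul_apply]
    simp only [Matrix.transpose_apply, incidenceMatrix, Matrix.of_apply, mul_ite, mul_one,
      mul_zero, ← ite_and]
    rw [Finset.sum_boole, ← Fintype.card_subtype, ← Nat.card_eq_fintype_card]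
    congr 1
    refine Nat.card_congr ((Equiv.subtypeSubtypeEquivSubtypeInter (· ∈ D)
      fun B => (R : Submodule K V) ≤ B ∧ (P : Submodule K V) ≤ B).trans
      (Equiv.subtypeEquivRight fun B => ?_))
    rw [Set.mem_ofPred_eq, sup_le_iff, and_comm (a := (R : Submodule K V) ≤ B)]
  rw [hentry, Matrix.add_apply, Matrix.smul_apply, Matrix.smul_apply, Matrix.sub_apply,
    collinMatrix, Matrix.of_apply]
  by_cases hPR : P = R
  · subst hPR
    rw [sup_idem, h₁ _ P.2, if_pos (Φ.contains_iff_le_perp.1 P.2.1).2]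
    simp
  · rw [Matrix.one_apply_ne hPR]
    split_ifs with hperp
    · obtain ⟨y, hyR, hy0⟩ := Submodule.exists_mem_ne_zero_of_ne_bot (p := (R : Submodule K V))
        (fun h => by have := R.2.2; rw [h, finrank_bot] at this; omega)
      have hR := span_singleton_eq_point R hyR hy0
      have hyP : y ∉ (P : Submodule K V) := fun h => hPR (Subtype.ext
        ((span_singleton_eq_point P h hy0).symm.trans hR))
      have hfin : Module.finrank K ((P : Submodule K V) ⊔ R : Submodule K V) = 2 := by
        rw [← hR, finrank_sup_span_singleton hyP, P.2.2]
      rw [h₂ _ ⟨(Φ.contains_sup_iff P.2.1 R.2.1).2 hperp, hfin⟩]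
      simp
    · have hempty : {B | B ∈ D ∧ (P : Submodule K V) ⊔ R ≤ B} = ∅ := by
        refine Set.eq_empty_iff_forall_notMem.2 fun B hB => hperp ?_
        exact (Φ.contains_sup_iff P.2.1 R.2.1).1 (Φ.contains_mono hB.2 (hD hB.1).1)
      rw [hempty]
      simp

include Φ in
/-- The Gram matrix of the incidence matrix is a multiple of `C - θ`, with `θ` the least eigenvalue
of `C` if the blocks are maximal, and below all eigenvalues otherwise. -/
theorem rank_incidenceMatrix {D : Set (Submodule K V)} {k t lam : ℕ} (ht : 2 ≤ t)
    (hD : 𝒬.IsDesign t k lam D) (hlam : 1 ≤ lam) :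
    (k = 𝒬.rank → (𝒬.incidenceMatrix D).rank = 1 + 𝒬.m₁) ∧
    (k < 𝒬.rank → (𝒬.incidenceMatrix D).rank = Nat.card 𝒬.Point) := by
  classical
  have hq : (1 : ℝ) < Nat.card K := sub_pos.1 q_sub_one_pos
  obtain ⟨j, hj⟩ : ∃ j, 𝒬.rank = j + 2 := ⟨𝒬.rank - 2, by have := hD.t_le; omega⟩
  have htk : t ≤ k := by
    obtain ⟨T, hT⟩ := Φ.subspaces_nonempty hD.t_le
    have h := hD.ncard_eq T hT
    obtain ⟨B, hB, hTB⟩ := Set.nonempty_of_ncard_ne_zero (h.trans_ne (by omega))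
    rw [← hT.2, ← (hD.subset hB).2]
    exact Submodule.finrank_mono hTB
  obtain ⟨l₁, -, h₁⟩ := Φ.exists_ncard_blocks_eq hD hlam htk (t - 1) (by omega)
  obtain ⟨l₂, hl₂, h₂⟩ := Φ.exists_ncard_blocks_eq hD hlam htk (t - 2) (by omega)
  rw [show t - (t - 1) = 1 by omega] at h₁
  rw [show t - (t - 2) = 2 by omega] at h₂
  have hl₂' : (0 : ℝ) < l₂ := by exact_mod_cast hl₂
  have hl₂0 := hl₂'.ne'
  have hrel : (l₁ : ℝ) * ((Nat.card K : ℝ) ^ (k - 1) - 1) =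
      ((Nat.card K : ℝ) ^ (j + 1) - 1) * (1 + Φ.e) * l₂ := by
    obtain ⟨P, hP⟩ := Φ.subspaces_nonempty (s := 1) (by omega)
    have h := Φ.ncard_blocks_mul hD.subset h₂ hP
    rw [h₁ P hP, Φ.count_sub_pow (j := j + 1) (by omega) hP, pow_one,
      ← Nat.sub_add_cancel (show 1 ≤ k by omega), pow_succ] at h
    apply mul_right_cancel₀ (b := (Nat.card K : ℝ)) (by positivity)
    linear_combination h
  have hgram : 𝒬.incidenceMatrix D * (𝒬.incidenceMatrix D).transpose =
      (l₂ : ℝ) • (Φ.collinMatrix - (1 - l₁ / l₂ : ℝ) • 1) := by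
    rw [Φ.incidenceMatrix_mul_transpose hD.subset h₁ h₂]
    ext P R
    simp only [Matrix.add_apply, Matrix.smul_apply, Matrix.sub_apply, smul_eq_mul]
    field_simp
    ring
  have hrank := Matrix.rank_smul_add_finrank_eigenspace hl₂0 hgram
  rw [Matrix.rank_self_mul_transpose] at hrank
  have hpos : 0 < (Nat.card K : ℝ) ^ (k - 1) - 1 := sub_pos.2 (one_lt_pow₀ hq (by omega))
  constructor
  · intro hk
    have hθ : (1 - l₁ / l₂ : ℝ) = -Φ.e := by
      rw [hk, show 𝒬.rank - 1 = j + 1 by omega] at hrel hpos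
      have h : (l₁ : ℝ) = (1 + Φ.e) * l₂ :=
        mul_right_cancel₀ hpos.ne' (by linear_combination hrel)
      rw [h, mul_div_cancel_right₀ _ hl₂0]
      ring
    rw [hθ] at hrank
    have h := Φ.finrank_eigenspace_neg_e hj
    have h' : ((𝒬.incidenceMatrix D).rank : ℝ) + Module.finrank ℝ
        (Module.End.eigenspace (Matrix.toLin' Φ.collinMatrix) (-Φ.e)) =
        Fintype.card 𝒬.Point := by exact_mod_cast hrank
    rw [h] at h'
    have h2 : ((𝒬.incidenceMatrix D).rank : ℝ) = 1 + 𝒬.m₁ := by linarith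
    exact_mod_cast h2
  · intro hk
    have hθ : (1 - l₁ / l₂ : ℝ) < -Φ.e := by
      have hlt : (Nat.card K : ℝ) ^ (k - 1) < (Nat.card K : ℝ) ^ (j + 1) :=
        pow_lt_pow_right₀ hq (by omega)
      have h1 : 1 + Φ.e < l₁ / l₂ := by
        rw [lt_div_iff₀ hl₂']
        have h2 : 0 < (1 + Φ.e) * l₂ := mul_pos (by have := Φ.e_pos; linarith) hl₂'
        refine lt_of_mul_lt_mul_right ?_ hpos.le
        rw [hrel]
        nlinarith
      linarith
    rw [Φ.finrank_eigenspace_of_lt_neg_e hj hθ, add_zero] at hrank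
    rw [hrank, Nat.card_eq_fintype_card]

end FormData

end ClassicalPolarSpace

/-! ### The three kinds of forms -/

section Involution

variable {K : Type u} [Field K] [Finite K] {σ : K →+* K}

/-- The trace `z ↦ z + σ z` of an involution. -/
def involTrace (σ : K →+* K) : K →+ K where
  toFun z := z + σ z
  map_zero' := by simp
  map_add' x y := by rw [map_add]; ring

/-- The additive group of elements fixed by an endomorphism of a field. -/
def fixedElements (σ : K →+* K) : AddSubgroup K where
  carrier := {z | σ z = z}
  zero_mem' := map_zero σ
  add_mem' := fun {a b} (ha : σ a = a) (hb : σ b = b) => by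
    change σ (a + b) = a + b
    rw [map_add, ha, hb]
  neg_mem' := fun {a} (ha : σ a = a) => by
    change σ (-a) = -a
    rw [map_neg, ha]

omit [Finite K] in
theorem mem_fixedElements {z : K} : z ∈ fixedElements σ ↔ σ z = z := Iff.rfl

omit [Finite K] in
theorem card_ker_involTrace (hσ : Function.Involutive σ) (hne : σ ≠ RingHom.id K) :
    Nat.card (involTrace σ).ker = Nat.card (fixedElements σ) := by
  obtain ⟨z, hz⟩ : ∃ z, σ z ≠ z := by
    by_contra! h
    exact hne (RingHom.ext h)
  -- Multiplication by a skew element turns fixed elements into skew elements.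
  have hw : σ (z - σ z) = -(z - σ z) := by rw [map_sub, hσ z]; ring
  have hw0 : z - σ z ≠ 0 := sub_ne_zero.2 hz.symm
  have hto : ∀ a ∈ fixedElements σ, a * (z - σ z) ∈ (involTrace σ).ker := by
    intro a ha
    change a * (z - σ z) + σ (a * (z - σ z)) = 0
    rw [map_mul, mem_fixedElements.1 ha, hw]
    ring
  have hinv : ∀ b ∈ (involTrace σ).ker, b / (z - σ z) ∈ fixedElements σ := by
    intro b (hb : b + σ b = 0)
    rw [mem_fixedElements, map_div₀, hw, eq_neg_of_add_eq_zero_right hb, neg_div_neg_eq]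
  exact (Nat.card_congr
    { toFun := fun a => ⟨a.1 * (z - σ z), hto a.1 a.2⟩
      invFun := fun b => ⟨b.1 / (z - σ z), hinv b.1 b.2⟩
      left_inv := fun a => Subtype.ext (mul_div_cancel_right₀ a.1 hw0)
      right_inv := fun b => Subtype.ext (div_mul_cancel₀ b.1 hw0) }).symm

/-- The fixed field of an involution has index two, and the trace maps onto it. -/
theorem card_fixedElements (hσ : Function.Involutive σ) (hne : σ ≠ RingHom.id K) :
    Nat.card (fixedElements σ) ^ 2 = Nat.card K ∧ (involTrace σ).range = fixedElements σ := by
  have hle : (involTrace σ).range ≤ fixedElements σ := by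
    rintro _ ⟨z, rfl⟩
    change σ (z + σ z) = z + σ z
    rw [map_add, hσ z, add_comm]
  have hcard : Nat.card K = Nat.card (involTrace σ).range * Nat.card (fixedElements σ) := by
    rw [← card_ker_involTrace hσ hne, AddSubgroup.card_eq_card_quotient_mul_card_addSubgroup
      (involTrace σ).ker, Nat.card_congr (QuotientAddGroup.quotientKerEquivRange _).toEquiv]
  have hpos : 0 < Nat.card (fixedElements σ) := Nat.card_pos
  have h1 : Nat.card (fixedElements σ) * Nat.card (fixedElements σ) ≤ Nat.card K := by
    obtain ⟨z, hz⟩ : ∃ z, σ z ≠ z := by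
      by_contra! h
      exact hne (RingHom.ext h)
    rw [← Nat.card_prod]
    refine Nat.card_le_card_of_injective
      (fun p : fixedElements σ × fixedElements σ => p.1.1 + p.2.1 * z) ?_
    rintro ⟨⟨a, ha⟩, ⟨b, hb⟩⟩ ⟨⟨a', ha'⟩, ⟨b', hb'⟩⟩ h
    rw [mem_fixedElements] at ha hb ha' hb'
    change a + b * z = a' + b' * z at h
    have h' := congrArg σ h
    rw [map_add, map_add, map_mul, map_mul, ha, hb, ha', hb'] at h'
    have hbb : (b - b') * (σ z - z) = 0 := by linear_combination h' - h
    obtain rfl : b = b' := sub_eq_zero.1 ((mul_eq_zero.1 hbb).resolve_right (sub_ne_zero.2 hz))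
    obtain rfl : a = a' := add_right_cancel h
    rfl
  have h2 : Nat.card (fixedElements σ) ≤ Nat.card (involTrace σ).range := by
    rw [hcard] at h1
    exact Nat.le_of_mul_le_mul_right h1 hpos
  have heq := AddSubgroup.eq_of_le_of_card_ge hle h2
  rw [heq] at hcard
  exact ⟨by rw [hcard, sq], heq⟩

theorem card_add_involTrace_eq_zero (hσ : Function.Involutive σ) (hne : σ ≠ RingHom.id K)
    {c d : K} (hc : σ c = c) (hd : d ≠ 0) :
    Nat.card {a : K // c + (a * d + σ (a * d)) = 0} = Nat.card (fixedElements σ) := by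
  obtain ⟨z, hz⟩ : -c ∈ (involTrace σ).range := by
    rw [(card_fixedElements hσ hne).2, mem_fixedElements, map_neg, hc]
  have hz' : z + σ z = -c := hz
  rw [← card_ker_involTrace hσ hne]
  refine Nat.card_congr
    { toFun := fun a => ⟨a.1 * d - z, ?_⟩
      invFun := fun b => ⟨(b.1 + z) / d, ?_⟩
      left_inv := fun a => Subtype.ext (by
        change (a.1 * d - z + z) / d = a.1
        rw [sub_add_cancel, mul_div_cancel_right₀ _ hd])
      right_inv := fun b => Subtype.ext (by
        change (b.1 + z) / d * d - z = b.1
        rw [div_mul_cancel₀ _ hd, add_sub_cancel_right]) }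
  · change a.1 * d - z + σ (a.1 * d - z) = 0
    rw [map_sub]
    linear_combination a.2 - hz'
  · have hb : b.1 + σ b.1 = 0 := b.2
    change c + ((b.1 + z) / d * d + σ ((b.1 + z) / d * d)) = 0
    rw [div_mul_cancel₀ _ hd, map_add]
    linear_combination hb + hz'

end Involution

namespace ClassicalPolarSpace

variable {K : Type u} {V : Type v} [Field K] [AddCommGroup V] [Module K V]

section FormDataInstances

variable [Finite K]

/-- In the symplectic case, all vectors are singular. -/
noncomputable def formDataSymplectic (B : V →ₗ[K] V →ₗ[K] K) (alt : B.IsAlt)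
    (nondeg : B.Nondegenerate) : FormData (symplectic B alt nondeg) where
  σ := RingHom.id K
  B := B
  Sing _ := True
  h := Nat.card K
  isRefl := alt.isRefl
  sing_zero := trivial
  sing_smul _ _ _ := trivial
  sing_add _ _ _ := trivial
  self_eq_zero _ := alt _
  eq_zero _ h := nondeg.1 _ h
  card_sing _ _ := Nat.card_congr (Equiv.subtypeUnivEquiv fun _ => trivial)
  h_pos := Nat.card_pos
  contains_iff _ := ⟨fun h => ⟨fun _ _ => trivial, h⟩, fun h => h.2⟩

/-- In the Hermitian case, singular vectors on a coset correspond to the solutions of a trace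
equation. -/
noncomputable def formDataHermitian (σ : K →+* K) (hσ : Function.Involutive σ)
    (hne : σ ≠ RingHom.id K) (B : V →ₛₗ[σ] V →ₗ[K] K) (herm : B.IsSymm)
    (nondeg : B.Nondegenerate) : FormData (hermitian σ hσ hne B herm nondeg) where
  σ := σ
  B := B
  Sing x := B x x = 0
  h := Nat.card (fixedElements σ)
  isRefl := herm.isRefl
  sing_zero := by simp
  sing_smul a x hx := by simp [map_smulₛₗ, hx]
  sing_add {x y} hx hy hxy := by
    simp [map_add, LinearMap.add_apply, hx, hy, hxy, herm.isRefl x y hxy]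
  self_eq_zero hx := hx
  eq_zero _ h := nondeg.1 _ h
  card_sing {x y} hx hxy := by
    have hyx : B y x ≠ 0 := fun h => hxy (herm.isRefl y x h)
    rw [← card_add_involTrace_eq_zero hσ hne (herm.eq y y) hyx]
    refine Nat.card_congr (Equiv.subtypeEquivRight fun a => ?_)
    have h : B (y + a • x) (y + a • x) = B y y + (a * B y x + σ (a * B y x)) := by
      simp only [map_add, map_smulₛₗ, LinearMap.add_apply, LinearMap.smul_apply, smul_eq_mul,
        RingHom.id_apply, map_mul, herm.eq y x]
      rw [hx]
      ring
    rw [h]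
  h_pos := Nat.card_pos
  contains_iff _ := ⟨fun h => ⟨fun x hx => h x hx x hx, h⟩, fun h => h.2⟩

/-- In the quadratic case, the equation for singular vectors on a coset is linear. -/
noncomputable def formDataQuadratic (F : QuadraticForm K V) (nondeg : F.Nondegenerate) :
    FormData (quadratic F nondeg) where
  σ := RingHom.id K
  B := F.polarBilin
  Sing x := F x = 0
  h := 1
  isRefl x y h := by
    rw [QuadraticMap.polarBilin_apply_apply] at h ⊢
    rw [QuadraticMap.polar_comm, h]
  sing_zero := F.map_zero
  sing_smul a x hx := by rw [F.map_smul, hx, smul_zero]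
  sing_add {x y} hx hy hxy := by
    rw [QuadraticMap.polarBilin_apply_apply] at hxy
    rw [QuadraticMap.map_add F, hx, hy, hxy, add_zero, add_zero]
  self_eq_zero {x} hx := by
    rw [QuadraticMap.polarBilin_apply_apply, QuadraticMap.polar_self, hx, smul_zero]
  eq_zero {x} hx h := by
    have hmem : x ∈ F.radical := ⟨hx, LinearMap.ext h⟩
    rwa [nondeg.radical_eq_bot, Submodule.mem_bot] at hmem
  card_sing {x y} hx hxy := by
    rw [QuadraticMap.polarBilin_apply_apply, QuadraticMap.polar_comm] at hxy
    have h : ∀ a : K, F (y + a • x) = F y + a * QuadraticMap.polar F y x := by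
      intro a
      rw [QuadraticMap.map_add F, F.map_smul, hx, smul_zero, add_zero, QuadraticMap.polar_smul_right,
        smul_eq_mul]
    rw [Nat.card_eq_one_iff_unique]
    refine ⟨⟨fun a b => Subtype.ext (mul_right_cancel₀ hxy ?_)⟩,
      ⟨⟨-F y / QuadraticMap.polar F y x, ?_⟩⟩⟩
    · linear_combination (h a.1).symm + a.2 - (h b.1).symm - b.2
    · rw [h, div_mul_cancel₀ _ hxy, add_neg_cancel]
  h_pos := one_pos
  contains_iff U := by
    refine ⟨fun h => ⟨h, fun x hx y hy => ?_⟩, fun h => h.1⟩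
    rw [QuadraticMap.polarBilin_apply_apply, QuadraticMap.polar, h _ (U.add_mem hx hy), h x hx,
      h y hy]
    ring

end FormDataInstances

variable [Finite K] [FiniteDimensional K V]

omit [FiniteDimensional K V] in
theorem FormData.e_eq_rpow {𝒬 : ClassicalPolarSpace K V} (Φ : FormData 𝒬) {β : ℝ}
    (hh : (Φ.h : ℝ) = (Nat.card K : ℝ) ^ β)
    (heps : 𝒬.eps = (Module.finrank K V : ℝ) - 2 * 𝒬.rank - 1 + β) :
    Φ.e = (Nat.card K : ℝ) ^ ((𝒬.rank : ℝ) + 𝒬.eps - 1) := by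
  have hq : (0 : ℝ) < Nat.card K := by exact_mod_cast Nat.card_pos
  rw [e, hh, ← Real.rpow_natCast, ← Real.rpow_natCast, ← Real.rpow_add hq, ← Real.rpow_sub hq,
    heps]
  congr 1
  push_cast
  ring

/-- A symplectic space has dimension twice its rank, since all its vectors are singular. -/
theorem finrank_eq_two_mul_rank (B : V →ₗ[K] V →ₗ[K] K) (alt : B.IsAlt)
    (nondeg : B.Nondegenerate) :
    Module.finrank K V = 2 * (symplectic B alt nondeg).rank := by
  let Φ := formDataSymplectic B alt nondeg
  have hq : (1 : ℝ) < Nat.card K := sub_pos.1 FormData.q_sub_one_pos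
  have hq0 : (Nat.card K : ℝ) ≠ 0 := by positivity
  set r := (symplectic B alt nondeg).rank with hr
  obtain ⟨M, -, hMr⟩ := (symplectic B alt nondeg).isGreatest_rank.1
  obtain ⟨d, hd⟩ := Nat.exists_eq_add_of_le (hMr ▸ Submodule.finrank_le M :
    (symplectic B alt nondeg).rank ≤ Module.finrank K V)
  rw [← hr] at hd
  have hbot : (symplectic B alt nondeg).Contains ⊥ := Φ.contains_mono bot_le
    (symplectic B alt nondeg).isGreatest_rank.1.choose_spec.1
  have h := Φ.count_eq hbot (j := r) (by simp [hr])
  have hcount : Φ.count ⊥ = Nat.card K ^ (r + d) := by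
    rw [FormData.count, Φ.perp_bot, ← hd, ← Module.natCard_eq_pow_finrank (K := K) (V := V),
      ← Set.ncard_univ]
    congr 1
    exact Set.eq_univ_of_forall fun _ => ⟨trivial, trivial⟩
  have he : Φ.e = (Nat.card K : ℝ) * (Nat.card K : ℝ) ^ (r + d) / (Nat.card K : ℝ) ^ (r + 2) := by
    rw [FormData.e, hd]
    rfl
  have he' : Φ.e * Nat.card K = (Nat.card K : ℝ) ^ d := by
    rw [he]
    field_simp
    ring
  rw [hcount] at h
  push_cast at h
  have h2 : (Nat.card K : ℝ) ^ r = (Nat.card K : ℝ) ^ d := by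
    have h3 : (Nat.card K : ℝ) ^ (r + 1) = (Nat.card K : ℝ) ^ r * Nat.card K := pow_succ _ _
    rw [← hr, h3, pow_add] at h
    linear_combination (1 - (Nat.card K : ℝ) ^ r) * he' - h
  have h4 : r = d := pow_right_injective₀ (by linarith) hq.ne' h2
  omega

theorem exists_formData (𝒬 : ClassicalPolarSpace K V) :
    ∃ Φ : FormData 𝒬, Φ.e = (Nat.card K : ℝ) ^ ((𝒬.rank : ℝ) + 𝒬.eps - 1) := by
  cases 𝒬 with
  | symplectic B alt nondeg =>
    refine ⟨formDataSymplectic B alt nondeg, FormData.e_eq_rpow _ (β := 1) ?_ ?_⟩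
    · rw [Real.rpow_one]
      rfl
    · rw [finrank_eq_two_mul_rank B alt nondeg, eps]
      push_cast
      ring
  | hermitian σ hσ hne B herm nondeg =>
    refine ⟨formDataHermitian σ hσ hne B herm nondeg, FormData.e_eq_rpow _ (β := 1 / 2) ?_ ?_⟩
    · rw [← (card_fixedElements hσ hne).1, ← Real.sqrt_eq_rpow, Nat.cast_pow,
        Real.sqrt_sq (Nat.cast_nonneg _)]
      rfl
    · rw [eps]
      ring
  | quadratic F nondeg =>
    refine ⟨formDataQuadratic F nondeg, FormData.e_eq_rpow _ (β := 0) ?_ ?_⟩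
    · rw [Real.rpow_zero]
      exact Nat.cast_one
    · rw [eps]
      ring

end ClassicalPolarSpace

theorem mainTheorem10 {K : Type u} {V : Type v} [Field K] [Finite K] [AddCommGroup V] [Module K V]
    [FiniteDimensional K V] (𝒬 : ClassicalPolarSpace K V) (t k lam : ℕ)
    (ht : 2 ≤ t) (hlam : 1 ≤ lam) (D : Set (Submodule K V)) (hD : 𝒬.IsDesign t k lam D) :
    (k = 𝒬.rank → (𝒬.incidenceMatrix D).rank = 1 + 𝒬.m₁) ∧
    (k < 𝒬.rank → (𝒬.incidenceMatrix D).rank = Nat.card 𝒬.Point) ∧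
    (𝒬.m₁ : ℝ) =
      (Nat.card K : ℝ) ^ (𝒬.eps + 1) *
        (((Nat.card K : ℝ) ^ ((𝒬.rank : ℝ) + 𝒬.eps - 1) + 1) / ((Nat.card K : ℝ) ^ 𝒬.eps + 1)) *
        (((Nat.card K : ℝ) ^ 𝒬.rank - 1) / ((Nat.card K : ℝ) - 1)) := by
  obtain ⟨Φ, he⟩ := 𝒬.exists_formData
  obtain ⟨h1, h2⟩ := Φ.rank_incidenceMatrix ht hD hlam
  refine ⟨h1, h2, ?_⟩
  obtain ⟨j, hj⟩ : ∃ j, 𝒬.rank = j + 2 := ⟨𝒬.rank - 2, by have := hD.t_le; omega⟩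
  have hq : (0 : ℝ) < Nat.card K := by exact_mod_cast Nat.card_pos
  have hj' : (Nat.card K : ℝ) ^ (j + 1) = (Nat.card K : ℝ) ^ ((𝒬.rank : ℝ) - 1) := by
    rw [← Real.rpow_natCast, hj]
    congr 1
    push_cast
    ring
  have heps : Φ.e = (Nat.card K : ℝ) ^ 𝒬.eps * (Nat.card K : ℝ) ^ (j + 1) := by
    rw [he, hj', ← Real.rpow_add hq]
    congr 1
    ring
  have hpos : 0 < (Nat.card K : ℝ) ^ 𝒬.eps := Real.rpow_pos_of_pos hq _
  rw [Φ.m₁_eq hj, ← he, Real.rpow_add hq, Real.rpow_one]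
  congr 1
  have hpow : 0 < (Nat.card K : ℝ) ^ (j + 1) := pow_pos hq _
  rw [heps]
  field_simp
  ring
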